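/- All graphs are finite and simple. A branch decomposition of a graph $G$ is a pair $(T,\delta)$, where $T$ is a tree of maximum degree at most $3$ and $\delta$ is a bijection from $V(G)$ to the leaves of $T$ (the vertex of a one-vertex tree counts as a leaf). Each edge $e$ of $T$ induces a partition $(A_e,\overline{A_e})$ of $V(G)$, according to the two components of $T-e$; the mim-width of $(T,\delta)$ is the maximum, over all edges $e$ of $T$, of the size of a maximum induced matching in the bipartite graph $G[A_e,\overline{A_e}]$ formed by the edges of $G$ between $A_e$ and $\overline{A_e}$ (and $0$ if $T$ has no edge). The mim-width $\mathrm{mimw}(G)$ is the minimum mim-width of a branch decomposition of $G$, and $\mathrm{tw}(G)$ denotes the treewidth of $G$ (both are taken to be $0$ for the graph without vertices). A graph is $(H_1,\dots,H_k)$-free if it has no induced subgraph isomorphic to any $H_i$; $K_n$ and $P_n$ are the complete graph and the path on $n$ vertices, the diamond is $K_4$ minus an edge, and $+$ is disjoint union. For a graph $B=(V,E)$ let $B''$ be the graph with vertex set $X\cup Y\cup Z$, where $X=\{x_v: v\in V\}$, $Y=\{y_v: v\in V\}$ and $Z=\bigcup_{e\in E}\{z_e,z'_e\}$, obtained from the complete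 bipartite graph with vertex bipartition $(X,Y)$ by adding, for each edge $e\in E$ with endpoints $u$ and $v$, the two paths $x_uz_ey_v$ and $x_vz'_ey_u$. Theorem. The class of $(K_4,\text{diamond},P_6,P_2+P_4)$-free graphs has unbounded mim-width: for every integer $k$ there is such a graph $G$ with $\mathrm{mimw}(G)>k$. More precisely: 1. For every bipartite graph $B$, the graph $B''$ is $3$-partite with colour classes $X$, $Y$, $Z$ (each of which is an independent set), it is $(K_4,\text{diamond},P_6,P_2+P_4)$-free, and $\mathrm{mimw}(B'')\ge \mathrm{tw}(B)/6$. 2. For every integer $k\ge 0$ there is a bipartite graph $B$ with $\mathrm{tw}(B)>6k$ and $\mathrm{mimw}(B'')>k$. -/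

import Mathlib

open SimpleGraph

/-- `H.InducedFree G`: the graph `G` has no induced subgraph isomorphic to `H`. -/
def SimpleGraph.InducedFree {U W : Type*} (H : SimpleGraph U) (G : SimpleGraph W) : Prop :=
  ¬ H.IsIndContained G

/-- The diamond: the complete graph on four vertices with one edge removed. -/
def diamondGraph : SimpleGraph (Fin 4) :=
  (⊤ : SimpleGraph (Fin 4)).deleteEdges {s(0, 1)}

/-- `G` is `(K₄, diamond, P₆, P₂ + P₄)`-free. -/
def IsK4DiamondP6P2P4Free {W : Type*} (G : SimpleGraph W) : Prop :=
  (completeGraph (Fin 4)).InducedFree G ∧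
  diamondGraph.InducedFree G ∧
  (pathGraph 6).InducedFree G ∧
  (pathGraph 2 ⊕g pathGraph 4).InducedFree G

/-! ### Mim-width -/

/-- The bipartite graph `G[A, B]`: the edges of `G` between `A` and `B`. -/
def cutGraph {V : Type*} (G : SimpleGraph V) (A B : Set V) : SimpleGraph V where
  Adj u v := G.Adj u v ∧ ((u ∈ A ∧ v ∈ B) ∨ (u ∈ B ∧ v ∈ A))
  symm := ⟨fun _ _ h => ⟨h.1.symm, h.2.symm.imp And.symm And.symm⟩⟩
  loopless := ⟨fun _ h => G.loopless.irrefl _ h.1⟩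

/-- `M` is an induced matching of `H`: a set of edges of `H` such that distinct edges of `M` have
no common endpoint and no edge of `H` joins an endpoint of one to an endpoint of the other. -/
def IsInducedMatching {V : Type*} (H : SimpleGraph V) (M : Finset (Sym2 V)) : Prop :=
  (∀ e ∈ M, e ∈ H.edgeSet) ∧
  ∀ e ∈ M, ∀ f ∈ M, e ≠ f → ∀ u ∈ e, ∀ v ∈ f, u ≠ v ∧ ¬ H.Adj u v

/-- The maximum size of an induced matching in `G[A, B]` (for a finite graph). -/
noncomputable def cutMim {V : Type*} (G : SimpleGraph V) (A B : Set V) : ℕ :=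
  sSup {k | ∃ M : Finset (Sym2 V), IsInducedMatching (cutGraph G A B) M ∧ M.card = k}

/-- A branch decomposition of a (finite) graph with vertex set `V`: a finite tree of maximum degree
at most three and a bijection from `V` to its leaves. The only vertex of a one-vertex tree counts
as a leaf, so that a one-vertex graph has a branch decomposition as well. -/
structure BranchDecomposition (V : Type*) where
  /-- the nodes of the tree -/
  Node : Type
  finite_node : Finite Node
  /-- the tree -/
  tree : SimpleGraph Node
  isTree : tree.IsTree
  subcubic : ∀ t, (tree.neighborSet t).ncard ≤ 3
  /-- the bijection from the vertices to the leaves -/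
  leafEquiv : V ≃ {t : Node // (tree.neighborSet t).ncard ≤ 1}

/-- The vertices whose leaves lie in the component of `a` after the tree edge `ab` is removed. -/
def BranchDecomposition.side {V : Type*} (D : BranchDecomposition V) (a b : D.Node) : Set V :=
  {v | (D.tree.deleteEdges {s(a, b)}).Reachable a (D.leafEquiv v)}

/-- The mim-width of a branch decomposition: the maximum over all edges `ab` of the tree of the
maximum size of an induced matching across the induced partition (`0` for a tree without edges). -/
noncomputable def BranchDecomposition.mimWidth {V : Type*} (D : BranchDecomposition V)
    (G : SimpleGraph V) : ℕ :=
  sSup {k | ∃ a b, D.tree.Adj a b ∧ k = cutMim G (D.side a b) (D.side a b)ᶜ}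

/-- The mim-width of a finite graph: the minimum mim-width of a branch decomposition
(`0` for the graph without vertices). -/
noncomputable def SimpleGraph.mimWidth {V : Type*} (G : SimpleGraph V) : ℕ :=
  sInf {k | ∃ D : BranchDecomposition V, k = D.mimWidth G}

/-- A class of finite graphs has unbounded mim-width. -/
def HasUnboundedMimWidth (C : ∀ {W : Type}, SimpleGraph W → Prop) : Prop :=
  ∀ k : ℕ, ∃ (W : Type) (_ : Finite W) (G : SimpleGraph W), C G ∧ k < G.mimWidth

/-! ### Treewidth -/

/-- A tree decomposition of a (finite) graph. -/
structure TreeDecomposition {V : Type*} (G : SimpleGraph V) where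
  /-- the nodes of the tree -/
  Node : Type
  finite_node : Finite Node
  /-- the tree -/
  tree : SimpleGraph Node
  isTree : tree.IsTree
  /-- the bags -/
  bag : Node → Finset V
  mem_bag : ∀ v, ∃ t, v ∈ bag t
  adj_mem_bag : ∀ u v, G.Adj u v → ∃ t, u ∈ bag t ∧ v ∈ bag t
  connected : ∀ v, (tree.induce {t | v ∈ bag t}).Connected

/-- The width of a tree decomposition: the maximum size of a bag, minus one. -/
noncomputable def TreeDecomposition.width {V : Type*} {G : SimpleGraph V}
    (D : TreeDecomposition G) : ℕ :=
  (⨆ t, (D.bag t).card) - 1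

/-- The treewidth of a finite graph: the minimum width of a tree decomposition
(`0` for the graph without vertices). -/
noncomputable def SimpleGraph.treewidth {V : Type*} (G : SimpleGraph V) : ℕ :=
  sInf {k | ∃ D : TreeDecomposition G, k = D.width}

/-! ### The graph `B''` -/

/-- The vertices of `B''`: two copies `x v`, `y v` of every vertex `v` of `B`, and two vertices for
every edge of `B`, one for each of its two orientations. -/
inductive DoubleVertex {V : Type*} (B : SimpleGraph V)
  | x (v : V)
  | y (v : V)
  | z (d : B.Dart)

/-- The adjacent pairs of `B''`, each in one order: all pairs `x u`, `y v`, and for each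
orientation `(u, v)` of an edge of `B` the two edges of the path `x u`, `z (u, v)`, `y v`. -/
inductive DoubleRel {V : Type*} (B : SimpleGraph V) : DoubleVertex B → DoubleVertex B → Prop
  | xy (u v : V) : DoubleRel B (.x u) (.y v)
  | xz (d : B.Dart) : DoubleRel B (.x d.fst) (.z d)
  | zy (d : B.Dart) : DoubleRel B (.z d) (.y d.snd)

/-- The graph `B''`. -/
def doubleGraph {V : Type*} (B : SimpleGraph V) : SimpleGraph (DoubleVertex B) :=
  SimpleGraph.fromRel (DoubleRel B)

/-!
Fix a proper 2-colouring of `B`. Every vertex `v` of `B` gets a *hub* in `B''`, namely `x v` if `v`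
has colour `0` and `y v` if it has colour `1`, and every edge of `B` is represented by its vertex
`z d`, with `d` oriented from colour `0` to colour `1`. The representatives of the edges at `v`,
the *spokes* of `v`, are then adjacent to the hub of `v`.

Take a branch decomposition of `B''` of mim-width `k`, and let the subtree of `v` be the union of
the tree paths from the leaf of its hub to the leaves of its spokes. An edge of `B` is a spoke of
both its ends, so these subtrees form a tree decomposition of `B`. A tree edge of the subtree of
`v` separates the hub of `v` from one of its spokes. The vertices separated by a cut in this way
split into four classes, according to colour and to the side of the hub; within one class, hubs and
spokes induce a matching across the cut, because a vertex of `Z` has only one neighbour in `X` and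
one in `Y`. Hence a cut separates at most `4 k` vertices (`doubleGraph.ncard_separated_le`). A
vertex in the bag of an inner node is separated by at least two of the at most three incident tree
edges, so the bag has at most `6 k` vertices; the bags of leaves are handled directly. This proves
`treewidth_le_six_mul_mimWidth`.

That the minimum in the definition of mim-width is attained needs a branch decomposition of an
arbitrary finite nonempty set, for which a caterpillar serves. Large treewidth comes from the
complete bipartite graphs: the treewidth of a graph is at least its minimum degree.

The forbidden induced subgraphs are excluded by looking at how their vertices are distributed over
`X`, `Y` and `Z`: `X` and `Y` are completely joined, and a vertex of `Z` has at most one neighbour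
in each of them.
-/

/-! ### The graph `B''` and its forbidden induced subgraphs -/

namespace DoubleVertex

variable {V : Type*} {B : SimpleGraph V}

/-- The colour class of a vertex of `B''`: `0` for `X`, `1` for `Y`, `2` for `Z`. -/
def part : DoubleVertex B → Fin 3
  | x _ => 0
  | y _ => 1
  | z _ => 2

instance [Finite V] : Finite (DoubleVertex B) := by
  have : Finite B.Dart := Finite.of_injective _ Dart.toProd_injective
  refine Finite.of_injective
    (fun w : DoubleVertex B => match w with
      | x v => (Sum.inl (v, true) : (V × Bool) ⊕ B.Dart)
      | y v => Sum.inl (v, false)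
      | z d => Sum.inr d) ?_
  rintro (_ | _ | _) (_ | _ | _) h <;> simp_all

end DoubleVertex

namespace doubleGraph

open DoubleVertex

variable {V : Type*} {B : SimpleGraph V}

@[simp] lemma not_adj_x_x (u v : V) : ¬ (doubleGraph B).Adj (x u) (x v) := by
  rintro ⟨-, h | h⟩ <;> cases h

@[simp] lemma not_adj_y_y (u v : V) : ¬ (doubleGraph B).Adj (y u) (y v) := by
  rintro ⟨-, h | h⟩ <;> cases h

@[simp] lemma not_adj_z_z (d e : B.Dart) : ¬ (doubleGraph B).Adj (z d) (z e) := by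
  rintro ⟨-, h | h⟩ <;> cases h

@[simp] lemma adj_x_y (u v : V) : (doubleGraph B).Adj (x u) (y v) :=
  ⟨by simp, Or.inl (.xy u v)⟩

@[simp] lemma adj_y_x (u v : V) : (doubleGraph B).Adj (y u) (x v) :=
  (adj_x_y v u).symm

@[simp] lemma adj_x_z {u : V} {d : B.Dart} : (doubleGraph B).Adj (x u) (z d) ↔ u = d.fst := by
  constructor
  · rintro ⟨-, h | h⟩ <;> cases h
    rfl
  · rintro rfl
    exact ⟨by simp, Or.inl (.xz d)⟩

@[simp] lemma adj_y_z {u : V} {d : B.Dart} : (doubleGraph B).Adj (y u) (z d) ↔ u = d.snd := by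
  constructor
  · rintro ⟨-, h | h⟩ <;> cases h
    rfl
  · rintro rfl
    exact ⟨by simp, Or.inr (.zy d)⟩

@[simp] lemma adj_z_x {u : V} {d : B.Dart} : (doubleGraph B).Adj (z d) (x u) ↔ u = d.fst := by
  rw [adj_comm, adj_x_z]

@[simp] lemma adj_z_y {u : V} {d : B.Dart} : (doubleGraph B).Adj (z d) (y u) ↔ u = d.snd := by
  rw [adj_comm, adj_y_z]

lemma part_ne_of_adj {a b : DoubleVertex B} (h : (doubleGraph B).Adj a b) :
    a.part ≠ b.part := by
  cases a <;> cases b <;> simp_all [part]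

lemma adj_of_part {a b : DoubleVertex B} (ha : a.part ≠ 2) (hb : b.part ≠ 2)
    (h : a.part ≠ b.part) : (doubleGraph B).Adj a b := by
  cases a <;> cases b <;> simp_all [part]

/-- A vertex of `Z` has at most one neighbour in each of `X` and `Y`. -/
lemma eq_of_adj_z {a b c : DoubleVertex B} (ha : a.part = 2) (hb : (doubleGraph B).Adj a b)
    (hc : (doubleGraph B).Adj a c) (h : b.part = c.part) : b = c := by
  cases a <;> cases b <;> cases c <;> simp_all [part]

/-- Two vertices of `Z` with two common neighbours are equal, as `B` has no multiple edges. -/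
lemma eq_of_common_neighbors {a b c d : DoubleVertex B} (ha : a.part = 2) (hb : b.part = 2)
    (hcd : c ≠ d) (hac : (doubleGraph B).Adj a c) (had : (doubleGraph B).Adj a d)
    (hbc : (doubleGraph B).Adj b c) (hbd : (doubleGraph B).Adj b d) : a = b := by
  cases a <;> cases b <;> simp_all only [part] <;> try contradiction
  rename_i e f
  have : e.fst = f.fst ∧ e.snd = f.snd := by
    cases c <;> cases d <;> simp_all
  exact congrArg z (Dart.toProd_injective (Prod.ext this.1 this.2))

lemma isIndepSet_of_part (S : Set (DoubleVertex B)) (i : Fin 3) (h : ∀ a ∈ S, a.part = i) :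
    (doubleGraph B).IsIndepSet S :=
  fun a ha b hb _ hab => part_ne_of_adj hab ((h a ha).trans (h b hb).symm)

theorem completeGraph_four_inducedFree :
    (completeGraph (Fin 4)).InducedFree (doubleGraph B) := by
  rintro ⟨e⟩
  have h : ∀ i j : Fin 4, i ≠ j → (e i).part ≠ (e j).part := fun i j hij =>
    part_ne_of_adj (e.map_adj_iff.2 hij)
  -- Pigeonhole: four pairwise adjacent vertices would need four colours.
  obtain ⟨i, j, hij, he⟩ := Fintype.exists_ne_map_eq_of_card_lt (fun i => (e i).part) (by simp)
  exact h i j hij he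

theorem diamond_inducedFree : diamondGraph.InducedFree (doubleGraph B) := by
  rintro ⟨e⟩
  have h : ∀ i j : Fin 4, (doubleGraph B).Adj (e i) (e j) ↔ diamondGraph.Adj i j :=
    fun i j => e.map_adj_iff
  have hinj : e 0 ≠ e 1 := e.injective.ne (by decide)
  have hinj' : e 2 ≠ e 3 := e.injective.ne (by decide)
  have h01 : ¬ (doubleGraph B).Adj (e 0) (e 1) := by rw [h]; simp [diamondGraph]
  have h02 : (doubleGraph B).Adj (e 0) (e 2) := by rw [h]; simp [diamondGraph]
  have h03 : (doubleGraph B).Adj (e 0) (e 3) := by rw [h]; simp [diamondGraph]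
  have h12 : (doubleGraph B).Adj (e 1) (e 2) := by rw [h]; simp [diamondGraph]
  have h13 : (doubleGraph B).Adj (e 1) (e 3) := by rw [h]; simp [diamondGraph]
  have h23 : (doubleGraph B).Adj (e 2) (e 3) := by rw [h]; simp [diamondGraph]
  have p02 := part_ne_of_adj h02
  have p03 := part_ne_of_adj h03
  have p12 := part_ne_of_adj h12
  have p13 := part_ne_of_adj h13
  have p23 := part_ne_of_adj h23
  have p01 : (e 0).part = (e 1).part := by omega
  by_cases hz : (e 0).part = 2
  · exact hinj (eq_of_common_neighbors hz (p01 ▸ hz) hinj' h02 h03 h12 h13)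
  · -- One of the two adjacent common neighbours lies in `Z` and has two neighbours in one class.
    by_cases hz2 : (e 2).part = 2
    · exact hinj (eq_of_adj_z hz2 h02.symm h12.symm p01)
    · exact hinj (eq_of_adj_z (by omega) h03.symm h13.symm p01)

/-- In `X ∪ Y`, being in different classes is the same as being adjacent. -/
lemma part_eq_of_not_adj {a b : DoubleVertex B} (ha : a.part ≠ 2) (hb : b.part ≠ 2)
    (h : ¬ (doubleGraph B).Adj a b) : a.part = b.part := by
  by_contra hab
  exact h (adj_of_part ha hb hab)

/-- If an induced path on six vertices meets both `X` and `Y`, it does so in at most three vertices,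
which are consecutive, and two of the remaining vertices are adjacent members of `Z`. Otherwise an
inner vertex of the path in `Z` has both its neighbours in the same class. -/
theorem path_six_inducedFree : (pathGraph 6).InducedFree (doubleGraph B) := by
  rintro ⟨e⟩
  have h : ∀ i j : Fin 6, (doubleGraph B).Adj (e i) (e j) ↔ (pathGraph 6).Adj i j :=
    fun i j => e.map_adj_iff
  simp only [pathGraph_adj] at h
  have hinj : ∀ i j : Fin 6, i ≠ j → e i ≠ e j := fun i j => e.injective.ne
  have hp : ∀ i j : Fin 6, (i.val + 1 = j.val ∨ j.val + 1 = i.val) → (e i).part ≠ (e j).part :=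
    fun i j hij => part_ne_of_adj ((h i j).2 hij)
  have hq : ∀ i j : Fin 6, ¬ (i.val + 1 = j.val ∨ j.val + 1 = i.val) → (e i).part ≠ 2 →
      (e j).part ≠ 2 → (e i).part = (e j).part :=
    fun i j hij hi hj => part_eq_of_not_adj hi hj (mt (h i j).1 hij)
  have hr : ∀ i j k : Fin 6, (i.val + 1 = j.val) → (j.val + 1 = k.val) →
      (e j).part = 2 → (e i).part ≠ (e k).part := fun i j k hij hjk hj hik =>
    hinj i k (by omega) (eq_of_adj_z hj ((h j i).2 (Or.inr hij)) ((h j k).2 (Or.inl hjk)) hik)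
  have a1 := hp 0 1 (by decide)
  have a2 := hp 1 2 (by decide)
  have a3 := hp 2 3 (by decide)
  have a4 := hp 3 4 (by decide)
  have a5 := hp 4 5 (by decide)
  have b1 := hr 0 1 2 rfl rfl
  have b2 := hr 1 2 3 rfl rfl
  have b3 := hr 2 3 4 rfl rfl
  have b4 := hr 3 4 5 rfl rfl
  have c02 := hq 0 2 (by decide)
  have c03 := hq 0 3 (by decide)
  have c04 := hq 0 4 (by decide)
  have c05 := hq 0 5 (by decide)
  have c13 := hq 1 3 (by decide)
  have c14 := hq 1 4 (by decide)
  have c15 := hq 1 5 (by decide)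
  have c24 := hq 2 4 (by decide)
  have c25 := hq 2 5 (by decide)
  have c35 := hq 3 5 (by decide)
  -- The facts above about the classes of the six vertices are contradictory.
  clear hp hq hr hinj h
  generalize (e 0).part = p0 at *
  generalize (e 1).part = p1 at *
  generalize (e 2).part = p2 at *
  generalize (e 3).part = p3 at *
  generalize (e 4).part = p4 at *
  generalize (e 5).part = p5 at *
  grind

theorem path_two_sum_path_four_inducedFree :
    (pathGraph 2 ⊕g pathGraph 4).InducedFree (doubleGraph B) := by
  rintro ⟨e⟩
  have hll : (doubleGraph B).Adj (e (.inl 0)) (e (.inl 1)) := by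
    rw [e.map_adj_iff]; simp [pathGraph_adj]
  have hrr : ∀ i j : Fin 4, i.val + 1 = j.val →
      (doubleGraph B).Adj (e (.inr i)) (e (.inr j)) := fun i j hij => by
    rw [e.map_adj_iff]; simp [pathGraph_adj, hij]
  have hlr : ∀ (i : Fin 2) (j : Fin 4), ¬ (doubleGraph B).Adj (e (.inl i)) (e (.inr j)) :=
    fun i j => by rw [e.map_adj_iff]; simp
  -- One end of the `P₂` lies in `X ∪ Y`, so all vertices of the `P₄` in `X ∪ Y` are in its class.
  obtain ⟨i, hi⟩ : ∃ i : Fin 2, (e (.inl i)).part ≠ 2 := by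
    by_contra! hcon
    exact part_ne_of_adj hll ((hcon 0).trans (hcon 1).symm)
  have hq : ∀ j : Fin 4, (e (.inr j)).part ≠ 2 → (e (.inr j)).part = (e (.inl i)).part :=
    fun j hj => (part_eq_of_not_adj hi hj (hlr i j)).symm
  have hp : ∀ j k : Fin 4, j.val + 1 = k.val → (e (.inr j)).part ≠ (e (.inr k)).part :=
    fun j k hjk => part_ne_of_adj (hrr j k hjk)
  -- An inner vertex of the `P₄` lies in `Z`, and both its neighbours lie in the same class.
  have hz : ∀ j k l : Fin 4, j.val + 1 = k.val → k.val + 1 = l.val →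
      (e (.inr k)).part ≠ 2 := fun j k l hjk hkl hk => by
    have hj := hq j (fun h => hp j k hjk (h.trans hk.symm))
    have hl := hq l (fun h => hp k l hkl (hk.trans h.symm))
    have := eq_of_adj_z hk (hrr j k hjk).symm (hrr k l hkl) (hj.trans hl.symm)
    have := Sum.inr.inj (e.injective this)
    omega
  have h1 := hq 1 (hz 0 1 2 rfl rfl)
  have h2 := hq 2 (hz 1 2 3 rfl rfl)
  exact hp 1 2 rfl (h1.trans h2.symm)

theorem isK4DiamondP6P2P4Free (B : SimpleGraph V) : IsK4DiamondP6P2P4Free (doubleGraph B) :=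
  ⟨completeGraph_four_inducedFree, diamond_inducedFree, path_six_inducedFree,
    path_two_sum_path_four_inducedFree⟩

end doubleGraph

/-! ### Existence of branch decompositions -/

/-- If every vertex `v` other than `r` has a parent of smaller rank, then joining each vertex to its
parent gives a tree. -/
theorem isTree_fromRel_parent {V : Type*} (r : V) (parent : V → V) (rank : V → ℕ)
    (h : ∀ v, v ≠ r → rank (parent v) < rank v) :
    (SimpleGraph.fromRel fun v w => v ≠ r ∧ w = parent v).IsTree := by
  have hadj : ∀ v, v ≠ r →
      (SimpleGraph.fromRel fun v w => v ≠ r ∧ w = parent v).Adj v (parent v) := fun v hv =>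
    ⟨fun hp => (h v hv).ne (congrArg rank hp.symm), Or.inl ⟨hv, rfl⟩⟩
  refine ⟨(connected_iff_exists_forall_reachable _).2 ⟨r, fun v => ?_⟩, fun u c hc => ?_⟩
  · induction hn : rank v using Nat.strong_induction_on generalizing v with
    | _ n ih =>
      by_cases hv : v = r
      · rw [hv]
      · exact (ih _ (hn ▸ h v hv) _ rfl).trans (hadj v hv).reachable.symm
  · classical
    -- Both neighbours on the cycle of a vertex of maximum rank are its parent.
    obtain ⟨v, hv, hmax⟩ := c.support.toFinset.exists_max_image rank ⟨u, by simp⟩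
    simp only [List.mem_toFinset] at hv hmax
    have key : ∀ w ∈ c.support,
        (SimpleGraph.fromRel fun v w => v ≠ r ∧ w = parent v).Adj v w → w = parent v := by
      rintro w hw ⟨-, ⟨-, h'⟩ | ⟨hwr, h'⟩⟩
      · exact h'
      · have h1 := h w hwr
        have h2 := hmax w hw
        rw [← h'] at h1
        omega
    have hc' := hc.rotate hv
    have hsup : ∀ w ∈ (c.rotate v hv).support, w ∈ c.support := fun w hw =>
      (c.mem_support_rotate_iff v hv).1 hw
    refine hc'.snd_ne_penultimate ((key _ (hsup _ (Walk.getVert_mem_support _ _)) ?_).trans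
      (key _ (hsup _ (Walk.getVert_mem_support _ _)) ?_).symm)
    · exact Walk.adj_snd hc'.not_nil
    · exact (Walk.adj_penultimate hc'.not_nil).symm

namespace BranchDecomposition

/-- The parent function of the caterpillar with spine `(0, false), …, (n - 1, false)`, in which each
spine node `(i, false)` carries the leaf `(i, true)`. -/
def caterpillarParent {n : ℕ} : Fin n × Bool → Fin n × Bool
  | (i, true) => (i, false)
  | (i, false) => (⟨i - 1, by omega⟩, false)

/-- The caterpillar with a spine of `n + 2` nodes, each of them carrying one leaf. -/
def caterpillar (n : ℕ) : SimpleGraph (Fin (n + 2) × Bool) :=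
  SimpleGraph.fromRel fun v w => v ≠ (0, false) ∧ w = caterpillarParent v

lemma caterpillar_isTree (n : ℕ) : (caterpillar n).IsTree := by
  refine isTree_fromRel_parent _ _ (fun v => v.1 + v.2.toNat) ?_
  rintro ⟨i, _ | _⟩ h
  · have : i.val ≠ 0 := fun h0 => h (Prod.ext (Fin.ext h0) rfl)
    simp only [caterpillarParent, Bool.toNat_false]
    omega
  · simp [caterpillarParent]

lemma caterpillar_neighborSet_leaf {n : ℕ} (i : Fin (n + 2)) :
    (caterpillar n).neighborSet (i, true) = {(i, false)} := by
  ext ⟨j, _ | _⟩ <;> simp [caterpillar, caterpillarParent, eq_comm]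

lemma caterpillar_adj_spine {n : ℕ} {i j : Fin (n + 2)} (h : i.val + 1 = j.val) :
    (caterpillar n).Adj (i, false) (j, false) := by
  have hpar : (i, false) = caterpillarParent (j, false) :=
    Prod.ext (Fin.ext (by simp only [caterpillarParent]; omega)) rfl
  refine ⟨fun hij => ?_, Or.inr ⟨fun hj => ?_, hpar⟩⟩
  · have := congrArg (fun p => p.1.val) hij
    dsimp only at this
    omega
  · have := congrArg (fun p => p.1.val) hj
    dsimp only [Fin.val_zero] at this
    omega

lemma caterpillar_one_lt_spine {n : ℕ} (i : Fin (n + 2)) :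
    1 < ((caterpillar n).neighborSet (i, false)).ncard := by
  rw [Set.one_lt_ncard_iff]
  have hl : (caterpillar n).Adj (i, false) (i, true) := by
    rw [adj_comm, ← mem_neighborSet, caterpillar_neighborSet_leaf]; rfl
  obtain ⟨j, hj⟩ : ∃ j, (caterpillar n).Adj (i, false) (j, false) := by
    by_cases h : i.val = 0
    · exact ⟨⟨1, by omega⟩, caterpillar_adj_spine (by simp [h])⟩
    · exact ⟨⟨i - 1, by omega⟩, (caterpillar_adj_spine (by simp; omega)).symm⟩
  exact ⟨(i, true), (j, false), hl, hj, by simp⟩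

lemma caterpillar_subcubic {n : ℕ} (t : Fin (n + 2) × Bool) :
    ((caterpillar n).neighborSet t).ncard ≤ 3 := by
  obtain ⟨i, _ | _⟩ := t
  · classical
    have hsub : (caterpillar n).neighborSet (i, false) ⊆
        (({(i, true), (⟨i - 1, by omega⟩, false),
          (⟨(i + 1) % (n + 2), Nat.mod_lt _ (by omega)⟩, false)} :
            Finset (Fin (n + 2) × Bool)) : Set (Fin (n + 2) × Bool)) := by
      push_cast
      rintro ⟨j, _ | _⟩ ⟨-, ⟨-, h⟩ | ⟨h0, h⟩⟩
      · exact Or.inr (Or.inl h)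
      · simp only [caterpillarParent, Prod.mk.injEq, Fin.ext_iff, and_true] at h
        simp only [ne_eq, Prod.mk.injEq, Fin.ext_iff, Fin.val_zero, and_true] at h0
        have : (i.val + 1) % (n + 2) = i.val + 1 := Nat.mod_eq_of_lt (by omega)
        refine Or.inr (Or.inr (Prod.ext (Fin.ext ?_) rfl))
        simp only [this]
        omega
      · simp [caterpillarParent] at h
      · simp only [caterpillarParent, Prod.mk.injEq, and_true] at h
        exact Or.inl (by rw [h])
    refine (Set.ncard_le_ncard hsub (Set.toFinite _)).trans ?_
    rw [Set.ncard_coe_finset]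
    exact Finset.card_le_three
  · rw [caterpillar_neighborSet_leaf, Set.ncard_singleton]
    omega

/-- Every finite nonempty set of vertices has a branch decomposition, so that the minimum in the
definition of mim-width is attained. -/
theorem nonempty_of_finite (V : Type*) [Finite V] [Nonempty V] :
    Nonempty (BranchDecomposition V) := by
  obtain ⟨n, ⟨e⟩⟩ := Finite.exists_equiv_fin V
  match n, e with
  | 0, e => exact (e (Classical.arbitrary V)).elim0
  | 1, e =>
    exact ⟨{
      Node := Unit
      finite_node := inferInstance
      tree := ⊥
      isTree := .of_subsingleton
      subcubic := fun t => by simp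
      leafEquiv := e.trans
        { toFun := fun _ => ⟨(), by simp⟩
          invFun := fun _ => 0
          left_inv := fun _ => Subsingleton.elim _ _
          right_inv := fun _ => Subsingleton.elim _ _ } }⟩
  | n + 2, e =>
    refine ⟨{
      Node := Fin (n + 2) × Bool
      finite_node := inferInstance
      tree := caterpillar n
      isTree := caterpillar_isTree n
      subcubic := caterpillar_subcubic
      leafEquiv := e.trans (Equiv.ofBijective
        (fun i => ⟨(i, true), by rw [caterpillar_neighborSet_leaf, Set.ncard_singleton]⟩)
        ⟨fun i j h => by simpa using h, ?_⟩) }⟩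
    rintro ⟨⟨i, _ | _⟩, h⟩
    · exact absurd h (caterpillar_one_lt_spine i).not_ge
    · exact ⟨i, rfl⟩

end BranchDecomposition

/-! ### Treewidth and minimum degree -/

namespace TreeDecomposition

/-- The tree decomposition with a single bag. -/
noncomputable def trivial {V : Type*} [Finite V] (G : SimpleGraph V) : TreeDecomposition G where
  Node := Unit
  finite_node := inferInstance
  tree := ⊥
  isTree := .of_subsingleton
  bag := fun _ => (Set.toFinite (Set.univ : Set V)).toFinset
  mem_bag := fun v => ⟨(), by simp⟩
  adj_mem_bag := fun u v _ => ⟨(), by simp⟩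
  connected := fun v => by
    have : Nonempty {t : Unit | v ∈ (Set.toFinite (Set.univ : Set V)).toFinset} :=
      ⟨⟨(), by simp⟩⟩
    exact (IsTree.of_subsingleton (G := (⊥ : SimpleGraph Unit).induce _)).connected

lemma treewidth_le_width {V : Type*} {G : SimpleGraph V} (D : TreeDecomposition G) :
    G.treewidth ≤ D.width :=
  Nat.sInf_le (s := {k | ∃ D : TreeDecomposition G, k = D.width}) ⟨D, rfl⟩

lemma card_bag_le_width_add_one {V : Type*} {G : SimpleGraph V} (D : TreeDecomposition G)
    (t : D.Node) : (D.bag t).card ≤ D.width + 1 := by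
  have := D.finite_node
  have h : (D.bag t).card ≤ ⨆ t, (D.bag t).card :=
    le_ciSup (f := fun t => (D.bag t).card) (Set.finite_range _).bddAbove t
  unfold width
  omega

lemma width_le {V : Type*} {G : SimpleGraph V} (D : TreeDecomposition G) {k : ℕ}
    (h : ∀ t, (D.bag t).card ≤ k + 1) : D.width ≤ k := by
  have := D.isTree.connected.nonempty
  have : ⨆ t, (D.bag t).card ≤ k + 1 := ciSup_le h
  unfold width
  omega

/-- Root the tree at `r`, and let `v` be a vertex whose bags stay as far as possible from `r`. The
bag closest to `r` among those containing `v` contains all neighbours of `v`. -/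
theorem exists_neighborSet_subset_bag {V : Type*} [Finite V] [Nonempty V] {G : SimpleGraph V}
    (D : TreeDecomposition G) : ∃ v t, v ∈ D.bag t ∧ ∀ w, G.Adj v w → w ∈ D.bag t := by
  obtain ⟨r⟩ := D.isTree.connected.nonempty
  have hconn := D.isTree.connected
  have htop : ∀ v, ∃ t, v ∈ D.bag t ∧ ∀ s, v ∈ D.bag s → D.tree.dist r t ≤ D.tree.dist r s := by
    intro v
    have := D.finite_node
    obtain ⟨t, ht, hmin⟩ := Set.exists_min_image {t | v ∈ D.bag t} (D.tree.dist r)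
      (Set.toFinite _) (D.mem_bag v)
    exact ⟨t, ht, hmin⟩
  choose top htop hmin using htop
  obtain ⟨v, hmax⟩ := Finite.exists_max fun v => D.tree.dist r (top v)
  refine ⟨v, top v, htop v, fun w hvw => ?_⟩
  by_contra hw
  -- The nodes below `top v`.
  let S : Set D.Node := {t | ∀ p : D.tree.Walk r t, top v ∈ p.support}
  -- The set `S` can only be left through `top v`.
  have hexit : ∀ a b, D.tree.Adj a b → a ∈ S → b ∉ S →
      a = top v ∧ ∃ q : D.tree.Walk r b, top v ∉ q.support := by
    intro a b hab ha hb
    simp only [S, Set.mem_ofPred_eq, not_forall] at ha hb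
    obtain ⟨q, hq⟩ := hb
    have := ha (q.concat hab.symm)
    rw [Walk.support_concat] at this
    simp only [List.mem_append, List.mem_singleton] at this
    exact ⟨(this.resolve_left hq).symm, q, hq⟩
  obtain ⟨s, hvs, hws⟩ := D.adj_mem_bag v w hvw
  have hs : s ∈ S := by
    by_contra hs
    obtain ⟨p⟩ := (D.connected v).preconnected ⟨top v, htop v⟩ ⟨s, hvs⟩
    obtain ⟨d, -, h1, h2⟩ := p.exists_boundary_dart (Subtype.val ⁻¹' S)
      (fun q => q.end_mem_support) hs
    have hadj : D.tree.Adj d.fst.val d.snd.val := d.adj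
    obtain ⟨h3, q, hq⟩ := hexit _ _ hadj h1 h2
    rw [h3] at hadj
    have hle := hmin v _ d.snd.2
    -- Two paths from `r` to the node outside `S`, of which only one visits `top v`.
    obtain ⟨p', hp', hlen⟩ := hconn.exists_path_of_dist r (top v)
    have hnot : d.snd.val ∉ p'.support := by
      classical
      intro hmem
      have h4 := Walk.length_takeUntil_lt_length hmem hadj.ne'
      have h5 := dist_le (p'.takeUntil _ hmem)
      omega
    classical
    have huniq : p'.concat hadj = q.toPath := congrArg Subtype.val
      ((D.isTree.isAcyclic.subsingleton_path _ _).elim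
        ⟨p'.concat hadj, hp'.concat hnot hadj⟩ q.toPath)
    have hmem : top v ∈ (p'.concat hadj).support := by
      rw [Walk.support_concat]; simp
    rw [huniq] at hmem
    exact hq (Walk.support_toPath_subset_support _ hmem)
  have hwS : top w ∈ S := by
    by_contra hwS
    obtain ⟨p⟩ := (D.connected w).preconnected ⟨s, hws⟩ ⟨top w, htop w⟩
    obtain ⟨d, -, h1, h2⟩ := p.exists_boundary_dart (Subtype.val ⁻¹' S) hs hwS
    have h3 := (hexit _ _ d.adj h1 h2).1
    exact hw (h3 ▸ d.fst.2)
  obtain ⟨p, hp⟩ := hconn.exists_walk_length_eq_dist r (top w)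
  have hne : top v ≠ top w := fun h => hw (h ▸ htop w)
  classical
  have h4 := Walk.length_takeUntil_lt_length (hwS p) hne
  have h5 := dist_le (p.takeUntil _ (hwS p))
  have h6 := hmax w
  omega

end TreeDecomposition

/-- The treewidth of a graph is at least its minimum degree. -/
theorem SimpleGraph.le_treewidth_of_le_ncard_neighborSet {V : Type*} [Finite V] [Nonempty V]
    {G : SimpleGraph V} {n : ℕ} (h : ∀ v, n ≤ (G.neighborSet v).ncard) : n ≤ G.treewidth := by
  obtain ⟨D, hD⟩ := Nat.sInf_mem
    (⟨_, TreeDecomposition.trivial G, rfl⟩ : {k | ∃ D : TreeDecomposition G, k = D.width}.Nonempty)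
  rw [treewidth, hD]
  obtain ⟨v, t, hv, ht⟩ := D.exists_neighborSet_subset_bag
  have hsub : insert v (G.neighborSet v) ⊆ (D.bag t : Set V) :=
    Set.insert_subset hv fun w hw => ht w hw
  have h1 := Set.ncard_le_ncard hsub (Set.toFinite _)
  rw [Set.ncard_insert_of_notMem (by simp), Set.ncard_coe_finset] at h1
  have h2 := D.card_bag_le_width_add_one t
  have h3 := h v
  omega

/-- The balanced complete bipartite graph has large treewidth. -/
theorem le_treewidth_completeBipartiteGraph {n : ℕ} (hn : 0 < n) :
    n ≤ (completeBipartiteGraph (Fin n) (Fin n)).treewidth := by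
  have : Nonempty (Fin n ⊕ Fin n) := ⟨.inl ⟨0, hn⟩⟩
  refine SimpleGraph.le_treewidth_of_le_ncard_neighborSet ?_
  have hcard : ∀ f : Fin n → Fin n ⊕ Fin n, f.Injective → (Set.range f).ncard = n := fun f hf => by
    rw [← Set.image_univ, Set.ncard_image_of_injective _ hf, Set.ncard_univ, Nat.card_fin]
  rintro (v | v)
  · refine (hcard Sum.inr Sum.inr_injective).ge.trans (Set.ncard_le_ncard ?_ (Set.toFinite _))
    rintro _ ⟨w, rfl⟩
    simp
  · refine (hcard Sum.inl Sum.inl_injective).ge.trans (Set.ncard_le_ncard ?_ (Set.toFinite _))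
    rintro _ ⟨w, rfl⟩
    simp

/-! ### Paths in trees -/

namespace SimpleGraph

variable {N : Type*} {T : SimpleGraph N}

lemma IsAcyclic.not_reachable_deleteEdges_of_mem_edges (hT : T.IsAcyclic) {u w a b : N}
    {p : T.Walk u w} (hp : p.IsPath) (he : s(a, b) ∈ p.edges) :
    ¬ (T.deleteEdges {s(a, b)}).Reachable u w := by
  classical
  rw [reachable_deleteEdges_iff_exists_walk]
  rintro ⟨q, hq⟩
  have h : p = q.toPath := congrArg Subtype.val ((hT.subsingleton_path _ _).elim ⟨p, hp⟩ q.toPath)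
  rw [h] at he
  exact hq (Walk.edges_toPath_subset_edges _ he)

lemma Connected.reachable_deleteEdges_or (hT : T.Connected) (a b t : N) :
    (T.deleteEdges {s(a, b)}).Reachable a t ∨ (T.deleteEdges {s(a, b)}).Reachable b t := by
  by_contra hcon
  obtain ⟨p⟩ := hT.preconnected a t
  obtain ⟨d, -, h1, h2⟩ := p.exists_boundary_dart
    {t | (T.deleteEdges {s(a, b)}).Reachable a t ∨ (T.deleteEdges {s(a, b)}).Reachable b t}
    (Or.inl .rfl) hcon
  by_cases hd : s(d.fst, d.snd) = s(a, b)
  · rcases Sym2.eq_iff.1 hd with ⟨-, h⟩ | ⟨-, h⟩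
    · exact h2 (Or.inr (h ▸ .rfl))
    · exact h2 (Or.inl (h ▸ .rfl))
  · have hadj : (T.deleteEdges {s(a, b)}).Adj d.fst d.snd := by
      rw [deleteEdges_adj]
      exact ⟨d.adj, hd⟩
    exact h2 (h1.imp (·.trans hadj.reachable) (·.trans hadj.reachable))

/-- The union of the paths from `c` to the nodes in `E`. -/
def pathHull (T : SimpleGraph N) (c : N) (E : Set N) : Set N :=
  {t | ∃ w ∈ E, ∃ p : T.Walk c w, p.IsPath ∧ t ∈ p.support}

lemma subset_pathHull (hT : T.Connected) (c : N) (E : Set N) : E ⊆ T.pathHull c E := by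
  intro w hw
  obtain ⟨p, hp⟩ := hT.exists_isPath c w
  exact ⟨w, hw, p, hp, p.end_mem_support⟩

lemma connected_induce_pathHull (c : N) {E : Set N} (hc : c ∈ E) :
    (T.induce (T.pathHull c E)).Connected := by
  refine induce_connected_of_patches c ⟨c, hc, .nil, by simp, by simp⟩ ?_
  rintro t ⟨w, hw, p, hp, ht⟩
  exact ⟨{s | s ∈ p.support}, fun s hs => ⟨w, hw, p, hp, hs⟩, p.start_mem_support, ht,
    (Walk.connected_induce_support p).preconnected _ _⟩

/-- An inner node of a path is incident with two edges of the path. -/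
lemma Walk.IsPath.exists_two_edges {u w t : N} {p : T.Walk u w} (hp : p.IsPath)
    (ht : t ∈ p.support) (hu : t ≠ u) (hw : t ≠ w) :
    ∃ a b, a ≠ b ∧ s(t, a) ∈ p.edges ∧ s(t, b) ∈ p.edges := by
  obtain ⟨i, rfl, hi⟩ := Walk.mem_support_iff_exists_getVert.1 ht
  have h0 : i ≠ 0 := fun h => hu (by rw [h, Walk.getVert_zero])
  have h1 : i ≠ p.length := fun h => hw (by rw [h, Walk.getVert_length])
  have h2 := hp.ncard_neighborSet_toSubgraph_internal_eq_two h0 (lt_of_le_of_ne hi h1)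
  obtain ⟨a, b, ha, hb, hab⟩ := (Set.one_lt_ncard_iff (Set.finite_of_ncard_ne_zero (by omega))).1
    (h2 ▸ Nat.one_lt_two)
  simp only [Subgraph.mem_neighborSet] at ha hb
  exact ⟨a, b, hab, p.mem_edges_toSubgraph.1 ha, p.mem_edges_toSubgraph.1 hb⟩

end SimpleGraph

/-! ### Induced matchings across a cut of `B''` -/

/-- Edges from `A` to `B` that are indexed by `S` and have no further adjacencies between their
ends in `A` and their ends in `B` form an induced matching of `G[A, B]`. -/
lemma ncard_le_cutMim {V ι : Type*} [Finite V] {G : SimpleGraph V} {A B : Set V}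
    (hAB : Disjoint A B) {S : Set ι} (f g : ι → V) (hf : ∀ i ∈ S, f i ∈ A) (hg : ∀ i ∈ S, g i ∈ B)
    (hadj : ∀ i ∈ S, ∀ j ∈ S, G.Adj (f i) (g j) ↔ i = j) : S.ncard ≤ cutMim G A B := by
  classical
  have hfg : ∀ i ∈ S, ∀ j ∈ S, f i ≠ g j := fun i hi j hj h =>
    Set.disjoint_left.1 hAB (hf i hi) (h ▸ hg j hj)
  have hfinj : ∀ i ∈ S, ∀ j ∈ S, f i = f j → i = j := fun i hi j hj h =>
    (hadj i hi j hj).1 (h ▸ (hadj j hj j hj).2 rfl)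
  have hginj : ∀ i ∈ S, ∀ j ∈ S, g i = g j → i = j := fun i hi j hj h =>
    (hadj i hi j hj).1 (h ▸ (hadj i hi i hi).2 rfl)
  have hS : S.Finite := Set.Finite.of_finite_image (Set.toFinite (f '' S))
    fun i hi j hj => hfinj i hi j hj
  have hbdd : BddAbove {k | ∃ M : Finset (Sym2 V), IsInducedMatching (cutGraph G A B) M ∧
      M.card = k} := by
    have : Fintype V := Fintype.ofFinite V
    refine ⟨Fintype.card (Sym2 V), ?_⟩
    rintro k ⟨M, -, rfl⟩
    exact Finset.card_le_univ M
  refine le_csSup hbdd ⟨hS.toFinset.image fun i => s(f i, g i), ⟨?_, ?_⟩, ?_⟩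
  · simp only [Finset.mem_image, Set.Finite.mem_toFinset]
    rintro _ ⟨i, hi, rfl⟩
    exact ⟨(hadj i hi i hi).2 rfl, Or.inl ⟨hf i hi, hg i hi⟩⟩
  · simp only [Finset.mem_image, Set.Finite.mem_toFinset]
    rintro _ ⟨i, hi, rfl⟩ _ ⟨j, hj, rfl⟩ hne u hu v hv
    have hij : i ≠ j := fun h => hne (by rw [h])
    have hA : ∀ i ∈ S, f i ∉ B := fun i hi => Set.disjoint_left.1 hAB (hf i hi)
    have hB : ∀ i ∈ S, g i ∉ A := fun i hi => Set.disjoint_right.1 hAB (hg i hi)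
    rcases Sym2.mem_iff.1 hu with rfl | rfl <;> rcases Sym2.mem_iff.1 hv with rfl | rfl
    · refine ⟨fun h => hij (hfinj i hi j hj h), ?_⟩
      rintro ⟨-, ⟨-, h⟩ | ⟨h, -⟩⟩
      · exact hA j hj h
      · exact hA i hi h
    · exact ⟨hfg i hi j hj, fun h => hij ((hadj i hi j hj).1 h.1)⟩
    · exact ⟨(hfg j hj i hi).symm, fun h => hij ((hadj j hj i hi).1 h.1.symm).symm⟩
    · refine ⟨fun h => hij (hginj i hi j hj h), ?_⟩
      rintro ⟨-, ⟨h, -⟩ | ⟨-, h⟩⟩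
      · exact hB i hi h
      · exact hB j hj h
  · rw [Finset.card_image_of_injOn, ← Set.ncard_eq_toFinset_card S hS]
    intro i hi j hj h
    simp only [Set.Finite.coe_toFinset] at hi hj
    rcases Sym2.eq_iff.1 h with ⟨h, -⟩ | ⟨h, -⟩
    · exact hfinj i hi j hj h
    · exact absurd h (hfg i hi j hj)

namespace doubleGraph

open DoubleVertex

variable {V : Type*} {B : SimpleGraph V}

/-- The representative of `v` in `B''`: one of its two copies, chosen by the colour of `v`. -/
def hub (c : B.Coloring (Fin 2)) (v : V) : DoubleVertex B :=
  if c v = 0 then x v else y v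

/-- The vertices `z (u, w)` with `u` of colour `0` that stand for the edges of `B` at `v`. There is
one of them for each edge of `B` at `v`, and it is adjacent to `hub c v`. -/
def spokes (c : B.Coloring (Fin 2)) (v : V) : Set (DoubleVertex B) :=
  {w | ∃ d : B.Dart, w = z d ∧ c d.fst = 0 ∧ (d.fst = v ∨ d.snd = v)}

lemma hub_injective (c : B.Coloring (Fin 2)) : (hub c).Injective := by
  intro u v h
  unfold hub at h
  split_ifs at h <;> simpa using h

lemma hub_notMem_spokes (c : B.Coloring (Fin 2)) (u v : V) : hub c u ∉ spokes c v := by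
  rintro ⟨d, h, -⟩
  unfold hub at h
  split_ifs at h

/-- Between hubs and spokes of vertices of the same colour, the only edges are those between a
vertex and itself. -/
lemma adj_hub_spoke {c : B.Coloring (Fin 2)} {u v : V} (huv : c u = c v) {w : DoubleVertex B}
    (hw : w ∈ spokes c v) : (doubleGraph B).Adj (hub c u) w ↔ u = v := by
  obtain ⟨d, rfl, hd, hv⟩ := hw
  have hne := c.valid d.adj
  rw [hd] at hne
  unfold hub
  rcases hv with rfl | rfl
  · rw [if_pos (huv.trans hd), adj_x_z]
  · rw [if_neg (by rw [huv]; exact hne.symm), adj_y_z]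

/-- A set `A` of vertices of `B''` separates `v` if it separates the hub of `v` from a spoke. -/
def separated (c : B.Coloring (Fin 2)) (A : Set (DoubleVertex B)) : Set V :=
  {v | ∃ w ∈ spokes c v, ¬ (hub c v ∈ A ↔ w ∈ A)}

/-- Among the separated vertices, those with the same colour and with the hub on the same side give
an induced matching across the cut, and there are four such classes. -/
theorem ncard_separated_le [Finite V] (c : B.Coloring (Fin 2)) (A : Set (DoubleVertex B)) :
    (separated c A).ncard ≤ 4 * cutMim (doubleGraph B) A Aᶜ := by
  classical
  let P (j : Fin 2) : Set V := {v | c v = j ∧ hub c v ∈ A ∧ ∃ w ∈ spokes c v, w ∉ A}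
  let Q (j : Fin 2) : Set V := {v | c v = j ∧ hub c v ∉ A ∧ ∃ w ∈ spokes c v, w ∈ A}
  have hP : ∀ j, (P j).ncard ≤ cutMim (doubleGraph B) A Aᶜ := by
    intro j
    have : ∀ v, ∃ w, v ∈ P j → w ∈ spokes c v ∧ w ∉ A := fun v => by
      by_cases hv : v ∈ P j
      · obtain ⟨w, hw⟩ := hv.2.2
        exact ⟨w, fun _ => hw⟩
      · exact ⟨hub c v, fun h => absurd h hv⟩
    choose g hg using this
    exact ncard_le_cutMim disjoint_compl_right (hub c) g (fun v hv => hv.2.1)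
      (fun v hv => (hg v hv).2)
      fun u hu v hv => adj_hub_spoke (hu.1.trans hv.1.symm) (hg v hv).1
  have hQ : ∀ j, (Q j).ncard ≤ cutMim (doubleGraph B) A Aᶜ := by
    intro j
    have : ∀ v, ∃ w, v ∈ Q j → w ∈ spokes c v ∧ w ∈ A := fun v => by
      by_cases hv : v ∈ Q j
      · obtain ⟨w, hw⟩ := hv.2.2
        exact ⟨w, fun _ => hw⟩
      · exact ⟨hub c v, fun h => absurd h hv⟩
    choose g hg using this
    refine ncard_le_cutMim disjoint_compl_right g (hub c) (fun v hv => (hg v hv).2)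
      (fun v hv => hv.2.1) fun u hu v hv => ?_
    rw [adj_comm, adj_hub_spoke (hv.1.trans hu.1.symm) (hg u hu).1, eq_comm]
  have hsub : separated c A ⊆ (P 0 ∪ P 1) ∪ (Q 0 ∪ Q 1) := by
    rintro v ⟨w, hw, hsep⟩
    have hcol : c v = 0 ∨ c v = 1 := by omega
    by_cases hv : hub c v ∈ A
    · have hwA : w ∉ A := fun h => hsep (iff_of_true hv h)
      exact Or.inl (hcol.imp (fun h => ⟨h, hv, w, hw, hwA⟩) fun h => ⟨h, hv, w, hw, hwA⟩)
    · have hwA : w ∈ A := not_not.1 fun h => hsep (iff_of_false hv h)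
      exact Or.inr (hcol.imp (fun h => ⟨h, hv, w, hw, hwA⟩) fun h => ⟨h, hv, w, hw, hwA⟩)
  have h1 := Set.ncard_le_ncard hsub (Set.toFinite _)
  have h2 := Set.ncard_union_le (P 0 ∪ P 1) (Q 0 ∪ Q 1)
  have h3 := Set.ncard_union_le (P 0) (P 1)
  have h4 := Set.ncard_union_le (Q 0) (Q 1)
  have := hP 0
  have := hP 1
  have := hQ 0
  have := hQ 1
  omega

end doubleGraph

/-! ### From branch decompositions of `B''` to tree decompositions of `B` -/

namespace BranchDecomposition

lemma not_mem_side_iff_of_mem_edges {W : Type*} (D : BranchDecomposition W) {u w : W}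
    {a b : D.Node} {p : D.tree.Walk (D.leafEquiv u) (D.leafEquiv w)} (hp : p.IsPath)
    (he : s(a, b) ∈ p.edges) : ¬ (u ∈ D.side a b ↔ w ∈ D.side a b) := by
  have hnot := D.isTree.isAcyclic.not_reachable_deleteEdges_of_mem_edges hp he
  have hor := D.isTree.connected.reachable_deleteEdges_or a b
  intro hiff
  by_cases hu : u ∈ D.side a b
  · exact hnot (Reachable.trans (Reachable.symm hu) (hiff.1 hu))
  · exact hnot (((hor _).resolve_left hu).symm.trans
      ((hor _).resolve_left fun hw => hu (hiff.2 hw)))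

lemma cutMim_le_mimWidth {W : Type*} (D : BranchDecomposition W) (G : SimpleGraph W)
    {a b : D.Node} (hab : D.tree.Adj a b) :
    cutMim G (D.side a b) (D.side a b)ᶜ ≤ D.mimWidth G := by
  have := D.finite_node
  refine le_csSup (Set.Finite.bddAbove ?_) ⟨a, b, hab, rfl⟩
  refine (Set.finite_range fun e : D.Node × D.Node =>
    cutMim G (D.side e.1 e.2) (D.side e.1 e.2)ᶜ).subset ?_
  rintro k ⟨a, b, -, rfl⟩
  exact ⟨(a, b), rfl⟩

variable {V : Type*} {B : SimpleGraph V}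

open doubleGraph DoubleVertex

/-- The subtree of the vertex `v` of `B` in a branch decomposition of `B''`: the union of the paths
from the leaf of its hub to the leaves of its spokes. -/
def subtree (D : BranchDecomposition (DoubleVertex B)) (c : B.Coloring (Fin 2)) (v : V) :
    Set D.Node :=
  D.tree.pathHull (D.leafEquiv (hub c v))
    ((fun w => (D.leafEquiv w : D.Node)) '' insert (hub c v) (spokes c v))

lemma leaf_mem_subtree (D : BranchDecomposition (DoubleVertex B)) (c : B.Coloring (Fin 2)) {v : V}
    {w : DoubleVertex B} (hw : w ∈ insert (hub c v) (spokes c v)) :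
    (D.leafEquiv w : D.Node) ∈ D.subtree c v :=
  subset_pathHull D.isTree.connected _ _ ⟨w, hw, rfl⟩

/-- The subtrees of the vertices of `B` are the subtrees of a tree decomposition of `B`. -/
noncomputable def toTreeDecomposition [Finite V] (D : BranchDecomposition (DoubleVertex B))
    (c : B.Coloring (Fin 2)) : TreeDecomposition B where
  Node := D.Node
  finite_node := D.finite_node
  tree := D.tree
  isTree := D.isTree
  bag t := (Set.toFinite {v | t ∈ D.subtree c v}).toFinset
  mem_bag v := ⟨D.leafEquiv (hub c v), by
    simpa using D.leaf_mem_subtree c (Set.mem_insert _ _)⟩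
  adj_mem_bag := by
    have key : ∀ u v, B.Adj u v → c u = 0 → ∃ t, t ∈ D.subtree c u ∧ t ∈ D.subtree c v :=
      fun u v huv hu => ⟨D.leafEquiv (z ⟨(u, v), huv⟩),
        D.leaf_mem_subtree c (Or.inr ⟨_, rfl, hu, Or.inl rfl⟩),
        D.leaf_mem_subtree c (Or.inr ⟨_, rfl, hu, Or.inr rfl⟩)⟩
    intro u v huv
    simp only [Set.Finite.mem_toFinset, Set.mem_ofPred_eq]
    by_cases hu : c u = 0
    · exact key u v huv hu
    · have := c.valid huv
      obtain ⟨t, h1, h2⟩ := key v u huv.symm (by omega)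
      exact ⟨t, h2, h1⟩
  connected v := by
    have : {t | v ∈ (Set.toFinite {v | t ∈ D.subtree c v}).toFinset} = D.subtree c v := by
      ext t; simp
    rw [this]
    exact connected_induce_pathHull _ ⟨_, Set.mem_insert _ _, rfl⟩

lemma mem_bag_toTreeDecomposition [Finite V] {D : BranchDecomposition (DoubleVertex B)}
    {c : B.Coloring (Fin 2)} {t : D.Node} {v : V} :
    v ∈ (D.toTreeDecomposition c).bag t ↔ t ∈ D.subtree c v := by
  simp [toTreeDecomposition]

/-- Every tree edge on a path from the hub of `v` to one of its spokes separates `v`. -/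
lemma mem_separated_of_mem_edges {D : BranchDecomposition (DoubleVertex B)}
    {c : B.Coloring (Fin 2)} {v : V} {w : DoubleVertex B} (hw : w ∈ insert (hub c v) (spokes c v))
    {p : D.tree.Walk (D.leafEquiv (hub c v)) (D.leafEquiv w)} (hp : p.IsPath) {a b : D.Node}
    (he : s(a, b) ∈ p.edges) : v ∈ separated c (D.side a b) := by
  have h := D.not_mem_side_iff_of_mem_edges hp he
  rcases hw with rfl | hw
  · exact absurd Iff.rfl h
  · exact ⟨w, hw, h⟩

lemma ncard_separated_side_le [Finite V] (D : BranchDecomposition (DoubleVertex B))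
    (c : B.Coloring (Fin 2)) {a b : D.Node} (hab : D.tree.Adj a b) :
    (separated c (D.side a b)).ncard ≤ 4 * D.mimWidth (doubleGraph B) :=
  (ncard_separated_le c _).trans (Nat.mul_le_mul_left 4 (D.cutMim_le_mimWidth _ hab))

/-- If `B` has an edge, then the first edge on the path from a hub to a spoke is a cut with a
nonempty induced matching. -/
lemma one_le_mimWidth_of_mem_spokes [Finite V] (D : BranchDecomposition (DoubleVertex B))
    {c : B.Coloring (Fin 2)} {v : V} {w : DoubleVertex B} (hw : w ∈ spokes c v) :
    1 ≤ D.mimWidth (doubleGraph B) := by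
  obtain ⟨p, hp⟩ := D.isTree.connected.exists_isPath (D.leafEquiv (hub c v)) (D.leafEquiv w)
  have hnil : ¬ p.Nil := fun h => by
    have := D.leafEquiv.injective (Subtype.ext h.eq)
    exact hub_notMem_spokes c v v (this ▸ hw)
  have hsep := mem_separated_of_mem_edges (Set.mem_insert_of_mem _ hw) hp
    (p.mk_start_snd_mem_edges hnil)
  have h1 := D.ncard_separated_side_le c (p.adj_snd hnil)
  have h2 : 0 < (separated c (D.side _ p.snd)).ncard :=
    (Set.ncard_pos (Set.toFinite _)).2 ⟨v, hsep⟩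
  omega

/-- At a node of degree at least two, each vertex in the bag is separated by two of the at most
three incident tree edges. -/
lemma card_bag_le_of_one_lt [Finite V] (D : BranchDecomposition (DoubleVertex B))
    (c : B.Coloring (Fin 2)) {t : D.Node} (ht : 1 < (D.tree.neighborSet t).ncard) :
    ((D.toTreeDecomposition c).bag t).card ≤ 6 * D.mimWidth (doubleGraph B) := by
  classical
  have := D.finite_node
  have hfin : (D.tree.neighborSet t).Finite := Set.toFinite _
  have hleaf : ∀ w, t ≠ D.leafEquiv w := fun w h => by
    have := (D.leafEquiv w).2
    rw [← h] at this
    omega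
  let r : V → D.Node → Prop := fun v a => v ∈ separated c (D.side t a)
  have hcount := Finset.card_mul_le_card_mul r (s := (D.toTreeDecomposition c).bag t)
    (t := hfin.toFinset) (m := 2) (n := 4 * D.mimWidth (doubleGraph B)) ?_ ?_
  · have h3 := D.subcubic t
    rw [Set.ncard_eq_toFinset_card _ hfin] at h3
    have := Nat.mul_le_mul_right (4 * D.mimWidth (doubleGraph B)) h3
    omega
  · intro v hv
    obtain ⟨_, ⟨w, hw, rfl⟩, p, hp, htp⟩ := mem_bag_toTreeDecomposition.1 hv
    obtain ⟨a, b, hab, ha, hb⟩ := hp.exists_two_edges htp (hleaf _) (hleaf _)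
    refine Nat.succ_le_of_lt (Finset.one_lt_card.2 ⟨a, ?_, b, ?_, hab⟩)
    · exact Finset.mem_filter.2 ⟨hfin.mem_toFinset.2 (p.adj_of_mem_edges ha),
        mem_separated_of_mem_edges hw hp ha⟩
    · exact Finset.mem_filter.2 ⟨hfin.mem_toFinset.2 (p.adj_of_mem_edges hb),
        mem_separated_of_mem_edges hw hp hb⟩
  · intro a ha
    refine le_trans ?_ (D.ncard_separated_side_le c (hfin.mem_toFinset.1 ha))
    rw [← Set.ncard_coe_finset]
    exact Set.ncard_le_ncard (fun v hv => (Finset.mem_filter.1 hv).2) (Set.toFinite _)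

/-- A leaf lies in the subtree of `v` only if it is the leaf of the hub of `v` or of a spoke. -/
lemma mem_of_leaf_mem_subtree {D : BranchDecomposition (DoubleVertex B)}
    {c : B.Coloring (Fin 2)} {w : DoubleVertex B} {v : V}
    (hv : (D.leafEquiv w : D.Node) ∈ D.subtree c v) : w ∈ insert (hub c v) (spokes c v) := by
  have := D.finite_node
  obtain ⟨_, ⟨w', hw', rfl⟩, p, hp, htp⟩ := hv
  by_contra hw
  have hne : ∀ w' ∈ insert (hub c v) (spokes c v),
      (D.leafEquiv w : D.Node) ≠ D.leafEquiv w' := fun w' hw' h =>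
    hw (D.leafEquiv.injective (Subtype.ext h) ▸ hw')
  obtain ⟨a, b, hab, ha, hb⟩ := hp.exists_two_edges htp (hne _ (Set.mem_insert _ _)) (hne _ hw')
  have h1 : 1 < (D.tree.neighborSet (D.leafEquiv w)).ncard :=
    (Set.one_lt_ncard_iff (Set.toFinite _)).2
      ⟨a, b, p.adj_of_mem_edges ha, p.adj_of_mem_edges hb, hab⟩
  exact h1.not_ge (D.leafEquiv w).2

/-- The bag of a leaf is the empty set, a single vertex, or the two ends of an edge. -/
lemma card_bag_leaf_le [Finite V] (D : BranchDecomposition (DoubleVertex B))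
    (c : B.Coloring (Fin 2)) (w : DoubleVertex B) :
    ((D.toTreeDecomposition c).bag (D.leafEquiv w : D.Node)).card ≤
      6 * D.mimWidth (doubleGraph B) + 1 := by
  classical
  have hmem : ∀ v ∈ (D.toTreeDecomposition c).bag (D.leafEquiv w : D.Node),
      w ∈ insert (hub c v) (spokes c v) := fun v hv =>
    mem_of_leaf_mem_subtree (mem_bag_toTreeDecomposition.1 hv)
  by_cases hw : ∃ v, w ∈ spokes c v
  · obtain ⟨v, hv⟩ := hw
    have h1 := D.one_le_mimWidth_of_mem_spokes hv
    have hv' := hv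
    obtain ⟨d, rfl, -, -⟩ := hv'
    have hsub : (D.toTreeDecomposition c).bag (D.leafEquiv (z d) : D.Node) ⊆ {d.fst, d.snd} := by
      intro u hu
      rcases hmem u hu with h | ⟨d', h, -, hd'⟩
      · exact absurd (h ▸ hv) (hub_notMem_spokes c u v)
      · cases h
        simpa [eq_comm] using hd'
    have h2 := (Finset.card_le_card hsub).trans Finset.card_le_two
    omega
  · have h1 : ((D.toTreeDecomposition c).bag (D.leafEquiv w : D.Node)).card ≤ 1 := by
      refine Finset.card_le_one.2 fun u hu v hv => hub_injective c ?_
      rw [← (hmem u hu).resolve_right fun h => hw ⟨u, h⟩,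
        ← (hmem v hv).resolve_right fun h => hw ⟨v, h⟩]
    omega

end BranchDecomposition

/-- A branch decomposition of `B''` of mim-width `k` gives a tree decomposition of `B` of width at
most `6 k`. -/
theorem treewidth_le_six_mul_mimWidth {V : Type*} [Finite V] {B : SimpleGraph V}
    (hB : B.IsBipartite) : B.treewidth ≤ 6 * (doubleGraph B).mimWidth := by
  obtain ⟨c⟩ := hB
  rcases isEmpty_or_nonempty V with hV | hV
  · refine (TreeDecomposition.trivial B).treewidth_le_width.trans ?_
    exact (TreeDecomposition.width_le _ fun t => by
      simp [Finset.eq_empty_of_isEmpty]).trans (Nat.zero_le _)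
  · have : Nonempty (DoubleVertex B) := ⟨.x (Classical.arbitrary V)⟩
    obtain ⟨D₀⟩ := BranchDecomposition.nonempty_of_finite (DoubleVertex B)
    obtain ⟨D, hD⟩ := Nat.sInf_mem (⟨_, D₀, rfl⟩ :
      {k | ∃ D : BranchDecomposition (DoubleVertex B), k = D.mimWidth (doubleGraph B)}.Nonempty)
    rw [SimpleGraph.mimWidth, hD]
    refine (D.toTreeDecomposition c).treewidth_le_width.trans (TreeDecomposition.width_le _ ?_)
    intro t
    by_cases ht : (D.tree.neighborSet t).ncard ≤ 1
    · obtain ⟨w, hw⟩ := D.leafEquiv.surjective ⟨t, ht⟩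
      have := D.card_bag_leaf_le c w
      rwa [hw] at this
    · exact (D.card_bag_le_of_one_lt c (not_le.1 ht)).trans (Nat.le_succ _)

theorem mainTheorem11 :
    -- the class has unbounded mim-width
    HasUnboundedMimWidth IsK4DiamondP6P2P4Free ∧
    -- for every finite bipartite graph `B`, the graph `B''` is 3-partite with classes `X`, `Y`, `Z`,
    -- belongs to the class, and has mim-width at least a sixth of the treewidth of `B`
    (∀ {V : Type*} [Finite V] (B : SimpleGraph V), B.IsBipartite →
      (doubleGraph B).IsIndepSet (Set.range DoubleVertex.x) ∧
      (doubleGraph B).IsIndepSet (Set.range DoubleVertex.y) ∧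
      (doubleGraph B).IsIndepSet (Set.range DoubleVertex.z) ∧
      IsK4DiamondP6P2P4Free (doubleGraph B) ∧
      (B.treewidth : ℝ) / 6 ≤ ((doubleGraph B).mimWidth : ℝ)) ∧
    -- the graphs `B''` witness the unboundedness
    (∀ k : ℕ, ∃ (V : Type) (_ : Finite V) (B : SimpleGraph V), B.IsBipartite ∧
      6 * k < B.treewidth ∧ k < (doubleGraph B).mimWidth) := by
  have h3 : ∀ k : ℕ, ∃ (V : Type) (_ : Finite V) (B : SimpleGraph V), B.IsBipartite ∧
      6 * k < B.treewidth ∧ k < (doubleGraph B).mimWidth := by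
    intro k
    let B := completeBipartiteGraph (Fin (6 * k + 1)) (Fin (6 * k + 1))
    have hB : B.IsBipartite := by
      simpa using (CompleteBipartiteGraph.bicoloring (Fin (6 * k + 1)) (Fin (6 * k + 1))).colorable
    have h1 : 6 * k + 1 ≤ B.treewidth := le_treewidth_completeBipartiteGraph (by omega)
    have h2 := treewidth_le_six_mul_mimWidth hB
    exact ⟨_, inferInstance, B, hB, by omega, by omega⟩
  refine ⟨fun k => ?_, fun {V} _ B hB => ⟨?_, ?_, ?_, ?_, ?_⟩, h3⟩
  · obtain ⟨V, _, B, -, -, hk⟩ := h3 k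
    exact ⟨DoubleVertex B, inferInstance, doubleGraph B,
      doubleGraph.isK4DiamondP6P2P4Free B, hk⟩
  · refine doubleGraph.isIndepSet_of_part _ 0 ?_
    rintro _ ⟨v, rfl⟩
    rfl
  · refine doubleGraph.isIndepSet_of_part _ 1 ?_
    rintro _ ⟨v, rfl⟩
    rfl
  · refine doubleGraph.isIndepSet_of_part _ 2 ?_
    rintro _ ⟨v, rfl⟩
    rfl
  · exact doubleGraph.isK4DiamondP6P2P4Free B
  · have h : (B.treewidth : ℝ) ≤ 6 * ((doubleGraph B).mimWidth : ℝ) := by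
      exact_mod_cast treewidth_le_six_mul_mimWidth hB
    linarith
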